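/- Let $(\alpha,\beta)\in\{(4,8),(8,4)\}$. Two points of $\mathbb{Z}^2$ are $4$-adjacent if their $\ell_1$ distance is $1$, and $8$-adjacent if their $\ell_\infty$ distance is $1$. Let $T\subset\mathbb{Z}^2$ be a finite $\alpha$-connected component of a binary image, where a binary image is a map from a subset of $\mathbb{Z}^2$ to $\{\text{black},\text{white}\}$ and an $\alpha$-connected component is a maximal nonempty set of pixels of one color that are pairwise joined by $\alpha$-adjacent sequences of pixels of that color. Let $P_\alpha(T)$ be the set of points of $\mathbb{Z}^2\setminus T$ that are $\alpha$-adjacent to a point of $T$, and let $G_\alpha(T)$ be the graph on $\mathbb{Z}^2$ in which two points of $P_\alpha(T)$ are joined if they are $\beta$-adjacent, two points of $\mathbb{Z}^2\setminus P_\alpha(T)$ are joined if they are $\alpha$-adjacent, and there are no other edges. Then $G_\alpha(T)$ has exactly one infinite connected component $E_\alpha(T)$, it is contained in $\mathbb{Z}^2\setminus P_\alpha(T)$, and the exterior site perimeter $$P_\alpha^{ext}(T):=\{z\in P_\alpha(T) : z \text{ is } \alpha\text{-adjacent to a point of } E_\alpha(T)\}$$ is a simple $\beta$-connected cycle; that is,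 the graph induced on $P_\alpha^{ext}(T)$ by $\beta$-adjacency is a (chordless) cycle, and its length is at least $4$ if $\beta=8$ and at least $8$ if $\beta=4$. -/

import Mathlib

/-- Pixels are the points of `ℤ²`. -/
abbrev Pixel : Type := ℤ × ℤ

/-- The parameter `α ∈ {4, 8}`. -/
inductive Conn : Type
  | four
  | eight

/-- The dual parameter `β`: `(α, β) = (4, 8)` or `(8, 4)`. -/
def Conn.dual : Conn → Conn
  | .four => .eight
  | .eight => .four

/-- The metrics `d₄` (the `ℓ¹` metric) and `d₈` (the `ℓ^∞` metric) on `ℤ²`. -/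
def Conn.dist : Conn → Pixel → Pixel → ℤ
  | .four, x, y => |x.1 - y.1| + |x.2 - y.2|
  | .eight, x, y => max |x.1 - y.1| |x.2 - y.2|

theorem Conn.dist_comm (α : Conn) (x y : Pixel) : α.dist x y = α.dist y x := by
  cases α <;> simp [Conn.dist, abs_sub_comm]

theorem Conn.dist_self (α : Conn) (x : Pixel) : α.dist x x = 0 := by
  cases α <;> simp [Conn.dist]

/-- The graph of `d_α`-adjacency on `ℤ²`. -/
def adjGraph (α : Conn) : SimpleGraph Pixel where
  Adj x y := α.dist x y = 1
  symm := ⟨fun x y h => by rw [α.dist_comm]; exact h⟩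
  loopless := ⟨fun x h => by rw [α.dist_self] at h; exact zero_ne_one h⟩

inductive Color : Type
  | black
  | white

/-- A binary image: a map from a subset of `ℤ²` to `{black, white}`; the value `none` marks the
pixels outside the domain of the image. -/
abbrev BinaryImage : Type := Pixel → Option Color

/-- The `α`-adjacency of pixels (in the domain of `I`) that have the same color. -/
def monochromaticGraph (α : Conn) (I : BinaryImage) : SimpleGraph Pixel where
  Adj x y := (adjGraph α).Adj x y ∧ ∃ c : Color, I x = some c ∧ I y = some c
  symm := ⟨fun _ _ h => ⟨h.1.symm, h.2.elim fun c hc => ⟨c, hc.2, hc.1⟩⟩⟩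
  loopless := ⟨fun _ h => h.1.ne rfl⟩

/-- `T` is an `α`-connected component of the image `I`: a maximal set of pixels of one color
that are joined to each other by `α`-adjacent sequences of pixels of that color. -/
def IsConnComponent (α : Conn) (I : BinaryImage) (T : Set Pixel) : Prop :=
  ∃ x : Pixel, (I x).isSome ∧ T = {y | (monochromaticGraph α I).Reachable x y}

/-- The graph `I_α` of an image: white pixels are joined when they are `α`-adjacent, black pixels
when they are `β`-adjacent. Pixels outside the domain of `I` are isolated. -/
def imageGraph (α : Conn) (I : BinaryImage) : SimpleGraph Pixel where
  Adj x y :=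
    (I x = some .white ∧ I y = some .white ∧ (adjGraph α).Adj x y) ∨
    (I x = some .black ∧ I y = some .black ∧ (adjGraph α.dual).Adj x y)
  symm := ⟨fun _ _ h => h.imp (fun h => ⟨h.2.1, h.1, h.2.2.symm⟩)
    (fun h => ⟨h.2.1, h.1, h.2.2.symm⟩)⟩
  loopless := ⟨fun _ h => h.elim (fun h => h.2.2.ne rfl) (fun h => h.2.2.ne rfl)⟩

/-- The site perimeter `P_α(T)`. -/
def sitePerimeter (α : Conn) (T : Set Pixel) : Set Pixel :=
  {z | z ∉ T ∧ ∃ t ∈ T, (adjGraph α).Adj z t}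

open Classical in
/-- The image on all of `ℤ²` whose set of black pixels is `P_α(T)`. -/
noncomputable def perimeterImage (α : Conn) (T : Set Pixel) : BinaryImage :=
  fun z => if z ∈ sitePerimeter α T then some .black else some .white

/-- The characteristic graph `G_α(T)` of the site perimeter. -/
noncomputable def charGraph (α : Conn) (T : Set Pixel) : SimpleGraph Pixel :=
  imageGraph α (perimeterImage α T)

/-- `E_α(T)`: the white pixels whose connected component in `G_α(T)` is infinite. (For finite `T`
there is exactly one infinite component; this is a part of the theorem.) -/
def exteriorRegion (α : Conn) (T : Set Pixel) : Set Pixel :=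
  {z | perimeterImage α T z = some .white ∧
    ((charGraph α T).connectedComponentMk z).supp.Infinite}

/-- The exterior site perimeter `P_α^ext(T)`. -/
def extSitePerimeter (α : Conn) (T : Set Pixel) : Set Pixel :=
  {z | z ∈ sitePerimeter α T ∧ ∃ e ∈ exteriorRegion α T, (adjGraph α).Adj z e}

/-- The least length of a nondegenerate cycle. It excludes the `8`-connected triangles and the
`2 × 2` square as a `4`-connected cycle, which surround no pixel. -/
def Conn.minCycleLength : Conn → ℕ
  | .four => 8
  | .eight => 4

/-- `S` is a simple `β`-connected cycle: the graph that `β`-adjacency induces on `S` is a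
(chordless) cycle, of nondegenerate length. -/
def IsSimpleCycle (β : Conn) (S : Set Pixel) : Prop :=
  ∃ n : ℕ, β.minCycleLength ≤ n ∧
    Nonempty ((adjGraph β).induce S ≃g SimpleGraph.cycleGraph n)

/-! Let `E` be the exterior region and `S` the exterior site perimeter. The cycle structure needs
only the facts collected in `Separates`: `T` and `E` are disjoint, non-adjacent and `α`-connected,
each point of `S` touches both, and `E` touches nothing else. Since a finite connected 2-regular
graph is a cycle, two facts remain.

Degree two. Neighbors `e ∈ E` and `t ∈ T` of `s ∈ S` cut the ring of eight neighbors of `s` into two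
arcs. Each arc leads from `E` to `T`, so it contains a `β`-neighbor of `s` in `S` (`exists_two`).
Two of them on one arc are impossible (`not_three`): joining the one nearer to `e` to `T` and the
other one to `E` gives disjoint connected sets that alternate around `s`, against a mod 2 Jordan
curve argument (`not_chordsCross`).

Connectedness. If `A` is a nonempty proper part of `S` closed under `β`-adjacency, the edges between
`E` and `A` form a mod 2 cocycle on the square lattice, hence the coboundary of some `φ`. This `φ`
is constant on `T` and on `E`, but passing from `T` to `E` changes it through `A` and not through `S
\ A` (`subset_of_closed`).

The infinite component is the one that contains the complement of a large box, and extreme points of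
`T` supply enough perimeter points for the length bound. -/

/-! ### Finite connected 2-regular graphs -/

namespace SimpleGraph

variable {V : Type*} {G : SimpleGraph V}

/-- A finite connected graph all of whose vertices have exactly two neighbors is a cycle. -/
theorem Connected.nonempty_iso_cycleGraph [Finite V] (hc : G.Connected)
    (h2 : ∀ v, (G.neighborSet v).ncard = 2) :
    Nonempty (G ≃g cycleGraph (Nat.card V)) := by
  classical
  have := Fintype.ofFinite V
  obtain ⟨v⟩ := hc.nonempty
  have hcyc : G.IsCycles := fun v _ => h2 v
  have hne : (G.neighborSet v).Nonempty := Set.nonempty_of_ncard_ne_zero (by simp [h2])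
  obtain ⟨p, hp, hverts⟩ := hcyc.exists_cycle_toSubgraph_verts_eq_connectedComponentSupp
    (c := G.connectedComponentMk v) rfl hne
  have hmem : ∀ x, x ∈ p.support := fun x => by
    rw [← Walk.mem_verts_toSubgraph, hverts]
    exact ConnectedComponent.sound (hc.preconnected x v)
  have hlen : p.length = Nat.card V := by
    have hall : p.support.tail.toFinset = Finset.univ := by
      ext x
      simp only [List.mem_toFinset, Finset.mem_univ, iff_true]
      have := hmem x
      rw [Walk.mem_support_iff] at this
      rcases this with rfl | h
      · exact Walk.end_mem_tail_support hp.not_nil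
      · exact h
    have := List.toFinset_card_of_nodup hp.support_nodup
    rw [hall, Finset.card_univ] at this
    rw [Nat.card_eq_fintype_card, this]
    simp
  have h3 := hp.three_le_length
  obtain ⟨f⟩ := (cycleGraph_isContained_iff (G := G) (n := Nat.card V) (by omega)).2
    ⟨v, p, hp, hlen⟩
  have hbij : Function.Bijective f.toHom :=
    (Nat.bijective_iff_injective_and_card _).2 ⟨f.injective, by simp⟩
  refine ⟨RelIso.symm ⟨Equiv.ofBijective _ hbij, ?_⟩⟩
  intro a b
  refine ⟨fun hab => ?_, fun hab => f.toHom.map_adj hab⟩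
  obtain ⟨n, hn⟩ : ∃ n, Nat.card V = n + 3 := ⟨Nat.card V - 3, by omega⟩
  have hdeg : ((cycleGraph (Nat.card V)).neighborSet a).ncard = 2 := by
    clear hab hbij b
    clear f
    revert a
    rw [hn]
    intro a
    rw [← cycleGraph_degree_three_le (v := a), ← card_neighborSet_eq_degree,
      ← Nat.card_coe_set_eq, Nat.card_eq_fintype_card]
  -- The bijective homomorphism reflects adjacency: the images of the two neighbors of `a` already
  -- exhaust the two neighbors of its image.
  have himg : f.toHom '' (cycleGraph (Nat.card V)).neighborSet a = G.neighborSet (f.toHom a) := by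
    refine Set.eq_of_subset_of_ncard_le ?_ ?_ (Set.toFinite _)
    · rintro _ ⟨c, hc, rfl⟩
      exact f.toHom.map_adj hc
    · rw [Set.ncard_image_of_injective _ f.injective, hdeg, h2]
  have : f.toHom b ∈ G.neighborSet (f.toHom a) := hab
  rw [← himg] at this
  obtain ⟨c, hc, hcb⟩ := this
  rwa [f.injective hcb] at hc

end SimpleGraph

/-! ### Crossing parities with horizontal rays -/

/-- Whether the segment `uv` crosses the horizontal ray that starts slightly above `p` and goes
to the right. -/
def rayCross (p u v : Pixel) : ZMod 2 :=
  if ((u.2 = p.2 ∧ v.2 = p.2 + 1) ∨ (v.2 = p.2 ∧ u.2 = p.2 + 1)) ∧ 2 * p.1 < u.1 + v.1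
  then 1 else 0

/-- The potential whose increments along a walk are the changes of `rayCross` as its base point
moves from `p` to `q`. -/
def rayShift (p q u : Pixel) : ZMod 2 :=
  if (q.2 = p.2 + 1 ∧ u.2 = q.2 ∧ q.1 < u.1) ∨ (p.2 = q.2 + 1 ∧ u.2 = p.2 ∧ p.1 < u.1)
  then 1 else 0

theorem adj_eight_iff {x y : Pixel} : (adjGraph .eight).Adj x y ↔
    x ≠ y ∧ x.1 ≤ y.1 + 1 ∧ y.1 ≤ x.1 + 1 ∧ x.2 ≤ y.2 + 1 ∧ y.2 ≤ x.2 + 1 := by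
  simp only [adjGraph, Conn.dist, ne_eq, Prod.ext_iff]
  grind

theorem adj_four_iff {x y : Pixel} : (adjGraph .four).Adj x y ↔
    (x.1 = y.1 ∧ (x.2 = y.2 + 1 ∨ y.2 = x.2 + 1)) ∨
    (x.2 = y.2 ∧ (x.1 = y.1 + 1 ∨ y.1 = x.1 + 1)) := by
  simp only [adjGraph, Conn.dist]
  grind

theorem adj_eight_of_adj {α : Conn} {x y : Pixel} (h : (adjGraph α).Adj x y) :
    (adjGraph .eight).Adj x y := by
  cases α with
  | eight => exact h
  | four =>
    rw [adj_four_iff] at h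
    rw [adj_eight_iff, ne_eq, Prod.ext_iff]
    omega

theorem zmod_two_ite_add {a b c d : Prop} [Decidable a] [Decidable b] [Decidable c] [Decidable d]
    (h : (a ↔ b) ↔ (c ↔ d)) :
    ((if a then 1 else 0) + (if b then 1 else 0) : ZMod 2) =
      (if c then 1 else 0) + (if d then 1 else 0) := by
  by_cases a <;> by_cases b <;> by_cases c <;> by_cases d <;> simp_all <;> decide

/-- Two segments with distinct midpoints; diagonals of a unit square have the same midpoint. -/
def NotCrossing (p q u v : Pixel) : Prop :=
  ¬ (u.1 + v.1 = p.1 + q.1 ∧ u.2 + v.2 = p.2 + q.2)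

/-- A horizontal move of the base point changes nothing. Otherwise the two rays bound a half-strip
around the lattice points to the right of the upper base point, and a segment crosses this boundary
an odd number of times exactly when one endpoint is among those points. Only a diagonal crossing
`pq` could slip in between the two starting points. -/
theorem rayCross_add_rayCross {p q u v : Pixel} (hpq : (adjGraph .eight).Adj p q)
    (huv : (adjGraph .eight).Adj u v) (hup : u ≠ p) (huq : u ≠ q) (hvp : v ≠ p) (hvq : v ≠ q)
    (hx : NotCrossing p q u v) :
    rayCross p u v + rayCross q u v = rayShift p q u + rayShift p q v := by
  obtain ⟨p1, p2⟩ := p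
  obtain ⟨q1, q2⟩ := q
  obtain ⟨u1, u2⟩ := u
  obtain ⟨v1, v2⟩ := v
  rw [adj_eight_iff] at hpq huv
  simp only [ne_eq, Prod.mk.injEq, NotCrossing] at *
  apply zmod_two_ite_add
  have h1 : q2 = p2 ∨ q2 = p2 + 1 ∨ p2 = q2 + 1 := by omega
  have h2 : u2 = v2 ∨ u2 = v2 + 1 ∨ v2 = u2 + 1 := by omega
  rcases h1 with h1 | h1 | h1 <;> rcases h2 with h2 | h2 | h2 <;> subst h1 <;> subst h2 <;> grind

/-- The graph of `α`-adjacency between points of `A`. -/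
def within (α : Conn) (A : Set Pixel) : SimpleGraph Pixel where
  Adj x y := (adjGraph α).Adj x y ∧ x ∈ A ∧ y ∈ A
  symm := ⟨fun _ _ h => ⟨h.1.symm, h.2.2, h.2.1⟩⟩
  loopless := ⟨fun _ h => h.1.ne rfl⟩

theorem within_mono (α : Conn) {A B : Set Pixel} (h : A ⊆ B) : within α A ≤ within α B :=
  fun _ _ hxy => ⟨hxy.1, h hxy.2.1, h hxy.2.2⟩

/-- The parity of the number of steps of a walk that cross the ray of `p`. -/
def walkCross (p : Pixel) {H : SimpleGraph Pixel} : {a b : Pixel} → H.Walk a b → ZMod 2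
  | _, _, .nil => 0
  | a, _, .cons (v := c) _ w => rayCross p a c + walkCross p w

/-- The shifts at interior vertices of the walk occur twice and cancel mod 2. -/
theorem walkCross_add_walkCross {α : Conn} {A : Set Pixel} {p q : Pixel}
    (hpq : (adjGraph .eight).Adj p q) (hp : p ∉ A) (hq : q ∉ A)
    (hx : ∀ x ∈ A, ∀ y ∈ A, (adjGraph α).Adj x y → NotCrossing p q x y)
    {a b : Pixel} (w : (within α A).Walk a b) :
    walkCross p w + walkCross q w = rayShift p q a + rayShift p q b := by
  induction w with
  | nil => simp [walkCross, CharTwo.add_self_eq_zero]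
  | @cons a c b h w ih =>
    have := rayCross_add_rayCross hpq (adj_eight_of_adj h.1)
      (fun e => hp (e ▸ h.2.1)) (fun e => hq (e ▸ h.2.1)) (fun e => hp (e ▸ h.2.2))
      (fun e => hq (e ▸ h.2.2)) (hx _ h.2.1 _ h.2.2 h.1)
    have h2 := CharTwo.add_self_eq_zero (rayShift p q c)
    simp only [walkCross]
    linear_combination this + ih + h2

/-! ### Alternating connected sets around a point -/

/-- The eight neighbors of the origin in cyclic order. -/
def ring : Fin 8 → Pixel :=
  ![(1, 0), (1, 1), (0, 1), (-1, 1), (-1, 0), (-1, -1), (0, -1), (1, -1)]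

theorem exists_ring {s x : Pixel} (h : (adjGraph .eight).Adj s x) : ∃ i, x = s + ring i := by
  obtain ⟨s1, s2⟩ := s
  obtain ⟨x1, x2⟩ := x
  rw [adj_eight_iff] at h
  simp only [ne_eq, Prod.mk.injEq] at h
  have h1 : x1 = s1 - 1 ∨ x1 = s1 ∨ x1 = s1 + 1 := by omega
  have h2 : x2 = s2 - 1 ∨ x2 = s2 ∨ x2 = s2 + 1 := by omega
  simp only [Fin.exists_fin_succ, Prod.ext_iff]
  simp [ring]
  omega

/-- The chords `pq` and `uv` of an octagon cross. -/
def ChordsCross (p q u v : Fin 8) : Prop :=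
  (0 < u - p ∧ u - p < q - p ∧ q - p < v - p) ∨ (0 < v - p ∧ v - p < q - p ∧ q - p < u - p)

instance (p q u v : Fin 8) : Decidable (ChordsCross p q u v) :=
  inferInstanceAs (Decidable (_ ∨ _))

theorem rayCross_add_left (s p u v : Pixel) :
    rayCross (s + p) (s + u) (s + v) = rayCross p u v := by
  unfold rayCross
  refine if_congr ?_ rfl rfl
  simp only [Prod.fst_add, Prod.snd_add]
  omega

theorem rayShift_add_left (s p q u : Pixel) :
    rayShift (s + p) (s + q) (s + u) = rayShift p q u := by
  unfold rayShift
  refine if_congr ?_ rfl rfl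
  simp only [Prod.fst_add, Prod.snd_add]
  omega

/-- The local contribution at the corner `u, 0, v` of a closed curve when the base point moves from
`p` through the corner to `q`. Invariance fails there because the base point hits the curve, so the
jump is found by enumeration. -/
theorem ring_crossing : ∀ p q u v : Fin 8, ChordsCross p q u v →
    rayCross (ring p) (ring u) 0 + rayCross (ring p) 0 (ring v) +
    (rayCross (ring q) (ring u) 0 + rayCross (ring q) 0 (ring v)) +
    (rayShift (ring p) 0 (ring v) + rayShift (ring p) 0 (ring u) +
    (rayShift 0 (ring q) (ring v) + rayShift 0 (ring q) (ring u))) = 1 := by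
  decide +kernel

/-- Two disjoint connected sets cannot alternate around a point that they avoid. -/
theorem not_chordsCross {α α' : Conn} {A B : Set Pixel} (hAB : Disjoint A B) {s : Pixel}
    (hsA : s ∉ A) (hsB : s ∉ B) {p q u v : Fin 8}
    (hu : s + ring u ∈ A) (hv : s + ring v ∈ A) (hp : s + ring p ∈ B) (hq : s + ring q ∈ B)
    (hA : (within α A).Reachable (s + ring v) (s + ring u))
    (hB : (within α' B).Reachable (s + ring p) (s + ring q))
    (hx : ∀ x ∈ A, ∀ y ∈ A, (adjGraph α).Adj x y → ∀ z ∈ B, ∀ w ∈ B, (adjGraph α').Adj z w →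
      NotCrossing z w x y)
    (hxp : ∀ x ∈ A, ∀ y ∈ A, (adjGraph α).Adj x y → NotCrossing (s + ring p) s x y)
    (hxq : ∀ x ∈ A, ∀ y ∈ A, (adjGraph α).Adj x y → NotCrossing s (s + ring q) x y)
    (hxu : ∀ z ∈ B, ∀ w ∈ B, (adjGraph α').Adj z w → NotCrossing z w (s + ring u) s)
    (hxv : ∀ z ∈ B, ∀ w ∈ B, (adjGraph α').Adj z w → NotCrossing z w s (s + ring v)) :
    ¬ ChordsCross p q u v := by
  intro hc
  have hnA : ∀ {z}, z ∈ B → z ∉ A := fun hz hz' => Set.disjoint_left.1 hAB hz' hz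
  have hadj : ∀ i, (adjGraph .eight).Adj s (s + ring i) := by
    intro i
    have : ∀ i, ring i ≠ 0 ∧ (ring i).1 ≤ 1 ∧ -1 ≤ (ring i).1 ∧ (ring i).2 ≤ 1 ∧
      -1 ≤ (ring i).2 := by decide
    obtain ⟨h0, h⟩ := this i
    rw [adj_eight_iff]
    refine ⟨fun e => h0 (by simpa using e.symm), ?_⟩
    simp only [Prod.fst_add, Prod.snd_add]
    omega
  obtain ⟨R⟩ := hA
  -- Crossing parity of the ray of `x` with the closed curve that goes from `s + ring u` through `s`
  -- to `s + ring v` and back along `R`. It is constant along edges of `B`.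
  let N : Pixel → ZMod 2 := fun x =>
    rayCross x (s + ring u) s + rayCross x s (s + ring v) + walkCross x R
  have hN : ∀ {z w}, (within α' B).Adj z w → N z = N w := by
    intro z w h
    have hzw := adj_eight_of_adj h.1
    have hzu : s + ring u ≠ z := fun e => hnA h.2.1 (e ▸ hu)
    have hwu : s + ring u ≠ w := fun e => hnA h.2.2 (e ▸ hu)
    have hzv : s + ring v ≠ z := fun e => hnA h.2.1 (e ▸ hv)
    have hwv : s + ring v ≠ w := fun e => hnA h.2.2 (e ▸ hv)
    have hzs : s ≠ z := fun e => hsB (e ▸ h.2.1)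
    have hws : s ≠ w := fun e => hsB (e ▸ h.2.2)
    have h1 := walkCross_add_walkCross hzw (hnA h.2.1) (hnA h.2.2)
      (fun x hxA y hyA hxy => hx x hxA y hyA hxy z h.2.1 w h.2.2 h.1) R
    have h2 := rayCross_add_rayCross hzw (hadj u).symm hzu hwu hzs hws (hxu z h.2.1 w h.2.2 h.1)
    have h3 := rayCross_add_rayCross hzw (hadj v) hzs hws hzv hwv (hxv z h.2.1 w h.2.2 h.1)
    rw [← sub_eq_zero, CharTwo.sub_eq_add]
    simp only [N]
    linear_combination h1 + h2 + h3 + CharTwo.add_self_eq_zero (rayShift z w (s + ring u)) +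
      CharTwo.add_self_eq_zero (rayShift z w (s + ring v)) +
      CharTwo.add_self_eq_zero (rayShift z w s)
  have hpq : N (s + ring p) = N (s + ring q) := by
    have hwalk : ∀ {z w}, (within α' B).Walk z w → N z = N w := by
      intro z w D
      induction D with
      | nil => rfl
      | cons h _ ih => exact (hN h).trans ih
    exact hB.elim hwalk
  -- The base point now goes from `p` to `q` through `s`; `R` avoids `s`, so only the corner at `s`
  -- is left to `ring_crossing`, which makes the parities differ.
  have h1 := walkCross_add_walkCross (hadj p).symm (hnA hp) hsA hxp R
  have h2 := walkCross_add_walkCross (hadj q) hsA (hnA hq) hxq R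
  have key := ring_crossing p q u v hc
  simp only [← rayCross_add_left s (ring _), ← rayShift_add_left s (ring _),
    ← rayShift_add_left s 0, add_zero] at key
  simp only [N] at hpq
  have h4 := CharTwo.add_self_eq_zero (walkCross s R)
  have : (1 : ZMod 2) = 0 := by
    rw [← sub_eq_zero, CharTwo.sub_eq_add] at hpq
    rw [← key]
    linear_combination hpq - h1 - h2 + h4
  exact one_ne_zero this

/-! ### Separating sets and their local structure -/

/-- `S` is the common boundary of the disjoint, non-adjacent connected sets `T` and `E`: every
point of `S` is adjacent to both, and `E` is adjacent to no other point. -/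
structure Separates (α : Conn) (T E S : Set Pixel) : Prop where
  disjoint : Disjoint T E
  not_adj : ∀ t ∈ T, ∀ e ∈ E, ¬ (adjGraph α).Adj t e
  connected_left : ∀ t ∈ T, ∀ t' ∈ T, (within α T).Reachable t t'
  connected_right : ∀ e ∈ E, ∀ e' ∈ E, (within α E).Reachable e e'
  disjoint_left : Disjoint T S
  disjoint_right : Disjoint E S
  exists_left : ∀ s ∈ S, ∃ t ∈ T, (adjGraph α).Adj s t
  exists_right : ∀ s ∈ S, ∃ e ∈ E, (adjGraph α).Adj s e
  mem_or_mem : ∀ e ∈ E, ∀ z, (adjGraph α).Adj e z → z ∈ E ∨ z ∈ S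

/-- The midpoint of a `4`-edge has exactly one half-integer coordinate, so it determines the edge
among all `8`-edges. -/
theorem notCrossing_of_adj_four {x y z w : Pixel} (hxy : (adjGraph .four).Adj x y)
    (hzw : (adjGraph .eight).Adj z w) (hx : x ≠ z) (hy : y ≠ z) : NotCrossing z w x y := by
  rw [adj_four_iff] at hxy
  rw [adj_eight_iff] at hzw
  simp only [ne_eq, Prod.ext_iff, NotCrossing] at *
  omega

theorem NotCrossing.swap {x y z w : Pixel} (h : NotCrossing z w x y) : NotCrossing x y z w :=
  fun h' => h ⟨h'.1.symm, h'.2.symm⟩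

/-- Distinct `8`-edges with a common midpoint are the diagonals of a unit square, whose corners are
pairwise `8`-adjacent. -/
theorem notCrossing_of_not_adj_eight {x y z w : Pixel} (hxy : (adjGraph .eight).Adj x y)
    (hzw : (adjGraph .eight).Adj z w) (hne : x ≠ z) (hn : ¬ (adjGraph .eight).Adj x z) :
    NotCrossing z w x y := by
  rw [adj_eight_iff] at *
  simp only [ne_eq, Prod.ext_iff, NotCrossing] at *
  omega

theorem NotCrossing.symm_right {x y z w : Pixel} (h : NotCrossing z w x y) :
    NotCrossing z w y x := by
  simp only [NotCrossing] at *
  omega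

theorem NotCrossing.symm_left {x y z w : Pixel} (h : NotCrossing z w x y) :
    NotCrossing w z x y := by
  simp only [NotCrossing] at *
  omega

namespace Separates

variable {α : Conn} {T E S : Set Pixel}

theorem not_eq (h : Separates α T E S) {t e : Pixel} (ht : t ∈ T) (he : e ∈ E) : t ≠ e :=
  fun eq => Set.disjoint_left.1 h.disjoint ht (eq ▸ he)

theorem reachable_insert {α : Conn} {A : Set Pixel} {t t' x : Pixel}
    (hr : (within α A).Reachable t t') (ht' : t' ∈ A) (hx : (adjGraph α).Adj x t') :
    (within α (insert x A)).Reachable t x :=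
  (hr.mono (within_mono α (Set.subset_insert x A))).trans
    (SimpleGraph.Adj.reachable ⟨hx.symm, Or.inr ht', Or.inl rfl⟩)

/-- An edge that meets `T` does not cross an edge that meets `E`. -/
theorem notCrossing (h : Separates α T E S) {x y z w : Pixel} (hxy : (adjGraph α).Adj x y)
    (hzw : (adjGraph α).Adj z w) (hx : x ∈ T ∨ y ∈ T) (hz : z ∈ E ∨ w ∈ E)
    (hxz : x ≠ z) (hyz : y ≠ z) : NotCrossing z w x y := by
  cases α with
  | four => exact notCrossing_of_adj_four hxy (adj_eight_of_adj hzw) hxz hyz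
  | eight =>
    rcases hx with hx | hx <;> rcases hz with hz | hz
    · exact notCrossing_of_not_adj_eight hxy hzw (h.not_eq hx hz) (h.not_adj _ hx _ hz)
    · exact (notCrossing_of_not_adj_eight hxy hzw.symm (h.not_eq hx hz)
        (h.not_adj _ hx _ hz)).symm_left
    · exact (notCrossing_of_not_adj_eight hxy.symm hzw (h.not_eq hx hz)
        (h.not_adj _ hx _ hz)).symm_right
    · exact (notCrossing_of_not_adj_eight hxy.symm hzw.symm (h.not_eq hx hz)
        (h.not_adj _ hx _ hz)).symm_left.symm_right

/-- An `α`-edge and a disjoint `β`-edge do not cross. -/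
theorem notCrossing_of_dual {x y z w : Pixel} (hxy : (adjGraph α).Adj x y)
    (hzw : (adjGraph α.dual).Adj z w) (hxz : x ≠ z) (hyz : y ≠ z) (hxw : x ≠ w) :
    NotCrossing z w x y := by
  cases α with
  | four => exact notCrossing_of_adj_four hxy hzw hxz hyz
  | eight => exact (notCrossing_of_adj_four hzw hxy hxz.symm hxw.symm).swap

/-- Since `x` touches `T` and `y` touches `E`, the sets `T ∪ {x}` and `E ∪ {y}` are disjoint,
connected and avoid `s`, so they cannot alternate around `s`. -/
theorem not_chordsCross (h : Separates α T E S) {s : Pixel} (hs : s ∈ S) {e t x y : Fin 8}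
    (he : s + ring e ∈ E) (ht : s + ring t ∈ T) (hx : s + ring x ∈ S) (hy : s + ring y ∈ S)
    (hse : (adjGraph α).Adj s (s + ring e)) (hst : (adjGraph α).Adj s (s + ring t))
    (hsx : (adjGraph α.dual).Adj s (s + ring x)) (hsy : (adjGraph α.dual).Adj s (s + ring y))
    (hxy : s + ring x ≠ s + ring y) :
    ¬ ChordsCross e y x t := by
  obtain ⟨t', ht', hxt'⟩ := h.exists_left _ hx
  obtain ⟨e', he', hye'⟩ := h.exists_right _ hy
  have hTS := Set.disjoint_left.1 h.disjoint_left
  have hES := Set.disjoint_left.1 h.disjoint_right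
  have hdisj : Disjoint (insert (s + ring x) T) (insert (s + ring y) E) := by
    rw [Set.disjoint_left]
    rintro a (rfl | ha) (hb | hb)
    · exact hxy hb
    · exact hES hb hx
    · exact hTS ha (hb ▸ hy)
    · exact h.not_eq ha hb rfl
  have hsA : s ∉ insert (s + ring x) T := by
    rintro (hs' | hs')
    · exact hsx.ne hs'
    · exact hTS hs' hs
  have hsB : s ∉ insert (s + ring y) E := by
    rintro (hs' | hs')
    · exact hsy.ne hs'
    · exact hES hs' hs
  have hneAB : ∀ {a b}, a ∈ insert (s + ring x) T → b ∈ insert (s + ring y) E → a ≠ b :=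
    fun ha hb eq => Set.disjoint_left.1 hdisj ha (eq ▸ hb)
  have hneA : ∀ {a}, a ∈ insert (s + ring x) T → a ≠ s := fun ha eq => hsA (eq ▸ ha)
  have hneB : ∀ {a}, a ∈ insert (s + ring y) E → a ≠ s := fun ha eq => hsB (eq ▸ ha)
  have hmemT : ∀ {a b}, a ∈ insert (s + ring x) T → b ∈ insert (s + ring x) T →
      (adjGraph α).Adj a b → a ∈ T ∨ b ∈ T := by
    rintro a b (rfl | ha) (rfl | hb) hab
    · exact (hab.ne rfl).elim
    all_goals tauto
  have hmemE : ∀ {a b}, a ∈ insert (s + ring y) E → b ∈ insert (s + ring y) E →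
      (adjGraph α).Adj a b → a ∈ E ∨ b ∈ E := by
    rintro a b (rfl | ha) (rfl | hb) hab
    · exact (hab.ne rfl).elim
    all_goals tauto
  refine _root_.not_chordsCross hdisj hsA hsB (Or.inl rfl) (Or.inr ht) (Or.inr he) (Or.inl rfl)
    (reachable_insert (h.connected_left _ ht _ ht') ht' hxt')
    (reachable_insert (h.connected_right _ he _ he') he' hye') ?_ ?_ ?_ ?_ ?_
  · intro a ha b hb hab z hz w hw hzw
    exact h.notCrossing hab hzw (hmemT ha hb hab) (hmemE hz hw hzw) (hneAB ha hz) (hneAB hb hz)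
  · intro a ha b hb hab
    exact h.notCrossing hab hse.symm (hmemT ha hb hab) (Or.inl he) (hneAB ha (Or.inr he))
      (hneAB hb (Or.inr he))
  · intro a ha b hb hab
    exact notCrossing_of_dual hab hsy (hneA ha) (hneA hb) (hneAB ha (Or.inl rfl))
  · intro z hz w hw hzw
    exact (notCrossing_of_dual hzw hsx.symm (hneAB (Or.inl rfl) hz).symm
      (hneAB (Or.inl rfl) hw).symm (hneB hz)).swap
  · intro z hz w hw hzw
    exact h.notCrossing hst hzw (Or.inr ht) (hmemE hz hw hzw) (hneB hz).symm (hneAB (Or.inr ht) hz)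

/-- Two points on the same side of the chord `et` give crossing chords. -/
theorem chordsCross_of_same_side {e t a b : Fin 8} (hte : t ≠ e) (hae : a ≠ e) (hat : a ≠ t)
    (hbe : b ≠ e) (hbt : b ≠ t) (hba : b ≠ a) (h : a - e < t - e ↔ b - e < t - e) :
    ChordsCross e b a t ∨ ChordsCross e a b t := by
  have hsub : ∀ {x y : Fin 8}, x ≠ y → x - e ≠ y - e := fun h h' => h (sub_left_injective h')
  have h0 : 0 < t - e := Fin.pos_iff_ne_zero.2 (sub_ne_zero.2 hte)
  have h1 : 0 < a - e := Fin.pos_iff_ne_zero.2 (sub_ne_zero.2 hae)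
  have h2 : 0 < b - e := Fin.pos_iff_ne_zero.2 (sub_ne_zero.2 hbe)
  unfold ChordsCross
  rcases (hsub hba).lt_or_gt with hlt | hlt <;> by_cases ht : a - e < t - e
  · exact Or.inr (Or.inl ⟨h2, hlt, ht⟩)
  · have := (hsub hbt).lt_of_le' (not_lt.1 fun h' => ht (h.2 h'))
    exact Or.inl (Or.inr ⟨h0, this, hlt⟩)
  · exact Or.inl (Or.inl ⟨h1, hlt, h.1 ht⟩)
  · have := (hsub hat).lt_of_le' (not_lt.1 ht)
    exact Or.inr (Or.inr ⟨h0, this, hlt⟩)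

/-- The chord `et` has two sides, so two of the three points share one. -/
theorem ring_pigeonhole {e t a b c : Fin 8} (hte : t ≠ e) (hae : a ≠ e) (hat : a ≠ t)
    (hbe : b ≠ e) (hbt : b ≠ t) (hba : b ≠ a) (hce : c ≠ e) (hct : c ≠ t) (hca : c ≠ a)
    (hcb : c ≠ b) :
    (ChordsCross e b a t ∨ ChordsCross e a b t) ∨ (ChordsCross e c a t ∨ ChordsCross e a c t) ∨
    (ChordsCross e b c t ∨ ChordsCross e c b t) := by
  have h1 := chordsCross_of_same_side hte hae hat hbe hbt hba
  have h2 := chordsCross_of_same_side hte hae hat hce hct hca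
  have h3 := chordsCross_of_same_side hte hce hct hbe hbt hcb.symm
  tauto

theorem not_three (h : Separates α T E S) {s a b c : Pixel} (hs : s ∈ S)
    (ha : a ∈ S) (hb : b ∈ S) (hc : c ∈ S) (hsa : (adjGraph α.dual).Adj s a)
    (hsb : (adjGraph α.dual).Adj s b) (hsc : (adjGraph α.dual).Adj s c)
    (hab : a ≠ b) (hac : a ≠ c) (hbc : b ≠ c) : False := by
  obtain ⟨t, ht, hst⟩ := h.exists_left _ hs
  obtain ⟨e, he, hse⟩ := h.exists_right _ hs
  have hTS := fun {x y} (hx : x ∈ T) (hy : y ∈ S) => h.disjoint_left.ne_of_mem hx hy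
  have hES := fun {x y} (hx : x ∈ E) (hy : y ∈ S) => h.disjoint_right.ne_of_mem hx hy
  have hTE := h.not_eq ht he
  have hta := hTS ht ha
  have htb := hTS ht hb
  have htc := hTS ht hc
  have hea := hES he ha
  have heb := hES he hb
  have hec := hES he hc
  obtain ⟨i, rfl⟩ := exists_ring (adj_eight_of_adj hse)
  obtain ⟨j, rfl⟩ := exists_ring (adj_eight_of_adj hst)
  obtain ⟨k, rfl⟩ := exists_ring (adj_eight_of_adj hsa)
  obtain ⟨l, rfl⟩ := exists_ring (adj_eight_of_adj hsb)
  obtain ⟨m, rfl⟩ := exists_ring (adj_eight_of_adj hsc)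
  have hne : ∀ {x y : Fin 8}, s + ring x ≠ s + ring y → x ≠ y := fun hxy e => hxy (by rw [e])
  rcases ring_pigeonhole (hne hTE) (hne hea.symm) (hne hta.symm) (hne heb.symm)
    (hne htb.symm) (hne hab.symm) (hne hec.symm) (hne htc.symm) (hne hac.symm) (hne hbc.symm)
    with (h1 | h1) | (h1 | h1) | (h1 | h1)
  · exact h.not_chordsCross hs he ht ha hb hse hst hsa hsb hab h1
  · exact h.not_chordsCross hs he ht hb ha hse hst hsb hsa hab.symm h1
  · exact h.not_chordsCross hs he ht ha hc hse hst hsa hsc hac h1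
  · exact h.not_chordsCross hs he ht hc ha hse hst hsc hsa hac.symm h1
  · exact h.not_chordsCross hs he ht hc hb hse hst hsc hsb hbc.symm h1
  · exact h.not_chordsCross hs he ht hb hc hse hst hsb hsc hbc h1

/-- Just after the last visit to `E`, the next point `α`-adjacent to it must lie in `S`. The second
alternative in `hr` skips a corner of the ring, which for `β = 4` is not a `β`-neighbor of `s`; the
skipped corner cannot be the end `r m`, since `T` and `E` are not adjacent. -/
theorem exists_mem_arc (h : Separates α T E S) {s : Pixel} {r : ℕ → Pixel}
    (hr : ∀ k, ((adjGraph α).Adj (r k) (r (k + 1)) ∧ (adjGraph α.dual).Adj s (r (k + 1))) ∨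
      ((adjGraph α).Adj (r k) (r (k + 1)) ∧ (adjGraph α).Adj (r k) (r (k + 2)) ∧
        (adjGraph α.dual).Adj s (r (k + 2))))
    {m : ℕ} (h0 : r 0 ∈ E) (hm : r m ∈ T) :
    ∃ k, 0 < k ∧ k < m ∧ r k ∈ S ∧ (adjGraph α.dual).Adj s (r k) := by
  classical
  have hTS := Set.disjoint_left.1 h.disjoint_left hm
  have hTE := Set.disjoint_left.1 h.disjoint hm
  let k := Nat.findGreatest (fun k => r k ∈ E) m
  have hk : r k ∈ E := Nat.findGreatest_spec (P := fun k => r k ∈ E) (Nat.zero_le m) h0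
  have hkm : k ≤ m := Nat.findGreatest_le m
  have hmax : ∀ j, k < j → j ≤ m → r j ∉ E := fun j hj hjm =>
    Nat.findGreatest_is_greatest (P := fun k => r k ∈ E) hj hjm
  have hne : k ≠ m := fun e => hTE (e ▸ hk)
  rcases hr k with ⟨h1, h2⟩ | ⟨h1, h2, h3⟩
  · have hS := (h.mem_or_mem _ hk _ h1).resolve_left (hmax _ (by omega) (by omega))
    have : k + 1 ≠ m := fun e => hTS (e ▸ hS)
    exact ⟨k + 1, by omega, by omega, hS, h2⟩
  · have : k + 1 ≠ m := fun e => h.not_adj _ hm _ hk (e ▸ h1.symm)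
    have hS := (h.mem_or_mem _ hk _ h2).resolve_left (hmax _ (by omega) (by omega))
    have : k + 2 ≠ m := fun e => hTS (e ▸ hS)
    exact ⟨k + 2, by omega, by omega, hS, h3⟩

theorem adj_add_left (α : Conn) (s x y : Pixel) :
    (adjGraph α).Adj (s + x) (s + y) ↔ (adjGraph α).Adj x y := by
  cases α <;> simp [adjGraph, Conn.dist]

theorem ring_step (α : Conn) (i d : Fin 8) (hd : d = 1 ∨ d = -1) :
    ((adjGraph α).Adj (ring i) (ring (i + d)) ∧ (adjGraph α.dual).Adj 0 (ring (i + d))) ∨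
      ((adjGraph α).Adj (ring i) (ring (i + d)) ∧ (adjGraph α).Adj (ring i) (ring (i + d + d)) ∧
        (adjGraph α.dual).Adj 0 (ring (i + d + d))) := by
  revert i
  rcases hd with rfl | rfl <;> cases α <;> simp only [adj_eight_iff, adj_four_iff, Conn.dual] <;>
    decide

open Fin.NatCast Fin.CommRing in
theorem exists_two (h : Separates α T E S) {s : Pixel} (hs : s ∈ S) :
    ∃ a ∈ S, ∃ b ∈ S, a ≠ b ∧ (adjGraph α.dual).Adj s a ∧ (adjGraph α.dual).Adj s b := by
  obtain ⟨t, ht, hst⟩ := h.exists_left _ hs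
  obtain ⟨e, he, hse⟩ := h.exists_right _ hs
  have hTE := h.not_eq ht he
  obtain ⟨i, rfl⟩ := exists_ring (adj_eight_of_adj hse)
  obtain ⟨j, rfl⟩ := exists_ring (adj_eight_of_adj hst)
  have hij : j ≠ i := fun e => hTE (by rw [e])
  have hstep : ∀ d : Fin 8, d = 1 ∨ d = -1 → ∀ k : ℕ,
      ((adjGraph α).Adj (s + ring (i + k * d)) (s + ring (i + (k + 1 : ℕ) * d)) ∧
        (adjGraph α.dual).Adj s (s + ring (i + (k + 1 : ℕ) * d))) ∨
      ((adjGraph α).Adj (s + ring (i + k * d)) (s + ring (i + (k + 1 : ℕ) * d)) ∧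
        (adjGraph α).Adj (s + ring (i + k * d)) (s + ring (i + (k + 2 : ℕ) * d)) ∧
        (adjGraph α.dual).Adj s (s + ring (i + (k + 2 : ℕ) * d))) := by
    intro d hd k
    have h1 : i + (k + 1 : ℕ) * d = i + k * d + d := by push_cast; ring
    have h2 : i + (k + 2 : ℕ) * d = i + k * d + d + d := by push_cast; ring
    have h3 : ∀ x, (adjGraph α.dual).Adj s (s + x) ↔ (adjGraph α.dual).Adj 0 x := fun x => by
      simpa using adj_add_left α.dual s 0 x
    rw [h1, h2, adj_add_left, adj_add_left, h3, h3]
    exact ring_step α _ d hd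
  obtain ⟨k, hk0, hkm, hkS, hk⟩ := h.exists_mem_arc (m := (j - i).val) (hstep 1 (Or.inl rfl))
    (by simpa using he) (by simpa using ht)
  obtain ⟨l, hl0, hlm, hlS, hl⟩ := h.exists_mem_arc (m := (i - j).val) (hstep (-1) (Or.inr rfl))
    (by simpa using he) (by simpa using ht)
  refine ⟨_, hkS, _, hlS, ?_, hk, hl⟩
  have hinj : Function.Injective ring := by decide
  intro heq
  have heq := hinj (add_left_cancel heq)
  -- The two arcs have total length 8 and both points are interior to their arcs, so `0 < k + l <
  -- 8`.
  have hkl : ((k + l : ℕ) : Fin 8) = 0 := by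
    push_cast
    linear_combination heq
  rw [Fin.natCast_eq_zero] at hkl
  have := Nat.le_of_dvd (by omega) hkl
  have hsum : (j - i).val + (i - j).val = 8 := by
    revert hij
    clear * -
    revert i j
    decide
  omega

theorem ncard_neighborSet (h : Separates α T E S) (s : S) :
    (((adjGraph α.dual).induce S).neighborSet s).ncard = 2 := by
  obtain ⟨a, ha, b, hb, hab, hsa, hsb⟩ := h.exists_two s.2
  rw [Set.ncard_eq_two]
  refine ⟨⟨a, ha⟩, ⟨b, hb⟩, fun e => hab (congrArg Subtype.val e), ?_⟩
  ext ⟨c, hc⟩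
  simp only [SimpleGraph.mem_neighborSet, SimpleGraph.comap_adj, Function.Embedding.subtype_apply,
    Set.mem_insert_iff, Set.mem_singleton_iff, Subtype.mk.injEq]
  refine ⟨fun hsc => ?_, ?_⟩
  · by_contra! hne
    exact h.not_three s.2 ha hb hc hsa hsb hsc hab hne.1.symm hne.2.symm
  · rintro (rfl | rfl)
    exacts [hsa, hsb]

end Separates

/-! ### Mod 2 potentials and connectedness of the boundary -/

theorem exists_antidifference (f : ℤ → ZMod 2) :
    ∃ F : ℤ → ZMod 2, F 0 = 0 ∧ ∀ n, F (n + 1) = F n + f n := by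
  -- At most one of the two intervals is nonempty; mod 2 the sum for negative `n` needs no sign.
  refine ⟨fun n => ∑ k ∈ Finset.Ico 0 n, f k + ∑ k ∈ Finset.Ico n 0, f k, by simp, fun n => ?_⟩
  dsimp only
  rcases le_or_gt 0 n with hn | hn
  · rw [Finset.Ico_eq_empty (a := n + 1) (b := 0) (by omega),
      Finset.Ico_eq_empty (a := n) (b := 0) (by omega), Finset.sum_empty, ← Finset.insert_Ico_right_eq_Ico_add_one hn,
      Finset.sum_insert (by simp)]
    ring
  · rw [Finset.Ico_eq_empty (a := 0) (b := n + 1) (by omega),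
      Finset.Ico_eq_empty (a := 0) (b := n) (by omega), Finset.sum_empty,
      ← Finset.insert_Ico_add_one_left_eq_Ico hn, Finset.sum_insert (by simp)]
    linear_combination -CharTwo.add_self_eq_zero (f n)

/-- A mod 2 edge weight on the square lattice that sums to zero around every unit square is a
coboundary. -/
theorem exists_potential (h v : ℤ → ℤ → ZMod 2)
    (hv : ∀ x y, h x y + v (x + 1) y = v x y + h x (y + 1)) :
    ∃ φ : Pixel → ZMod 2, (∀ x y, φ (x + 1, y) = φ (x, y) + h x y) ∧
      ∀ x y, φ (x, y + 1) = φ (x, y) + v x y := by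
  obtain ⟨V, -, hV⟩ := exists_antidifference (v 0)
  choose H hH0 hH using fun y => exists_antidifference (fun x => h x y)
  -- Integrate up the column `x = 0`, then along the row.
  refine ⟨fun p => V p.2 + H p.2 p.1, fun x y => ?_, fun x y => ?_⟩
  · simp only [hH]
    ring
  · simp only
    induction x using Int.induction_on with
    | zero => simp only [hH0, hV]; ring
    | succ n ih => linear_combination ih + hH (y + 1) n - hH y n - hv n y
    | pred n ih =>
      have h1 := hH (y + 1) (-n - 1)
      have h2 := hH y (-n - 1)
      have h3 := hv (-n - 1) y
      rw [sub_add_cancel] at h1 h2 h3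
      linear_combination ih - h1 + h2 + h3

open Classical in
/-- The indicator of the pairs with one point in `E` and the other one in `A`. -/
noncomputable def cutWeight (E A : Set Pixel) (x y : Pixel) : ZMod 2 :=
  if (x ∈ E ∧ y ∈ A) ∨ (y ∈ E ∧ x ∈ A) then 1 else 0

namespace Separates

variable {α : Conn} {T E S A : Set Pixel}

/-- For `α = 4`, the corners in `S` are pairwise `β`-adjacent, so either none is in `A` or every
edge leaving `E` counts, and a closed path leaves or enters `E` evenly often. For `α = 8`, once a
corner is in `E` all corners are in `E ∪ S`, and each run of `S`-corners lies inside or outside `A`,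
contributing two edges or none. -/
theorem cutWeight_square (h : Separates α T E S) (hA : A ⊆ S)
    (hcl : ∀ x ∈ A, ∀ y ∈ S, (adjGraph α.dual).Adj x y → y ∈ A) (x y : ℤ) :
    cutWeight E A (x, y) (x + 1, y) + cutWeight E A (x + 1, y) (x + 1, y + 1) =
      cutWeight E A (x, y) (x, y + 1) + cutWeight E A (x, y + 1) (x + 1, y + 1) := by
  classical
  have hES := Set.disjoint_right.1 h.disjoint_right
  have key : ∀ p q r s : Pixel, (adjGraph .four).Adj p q → (adjGraph .four).Adj q r →
      (adjGraph .four).Adj r s → (adjGraph .four).Adj s p →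
      (adjGraph .eight).Adj p r → (adjGraph .eight).Adj q s →
      cutWeight E A p q + cutWeight E A q r = cutWeight E A p s + cutWeight E A s r := by
    intro p q r s hpq hqr hrs hsp hpr hqs
    have hcl' : ∀ x y, (adjGraph α.dual).Adj x y → x ∈ S → y ∈ S → (x ∈ A ↔ y ∈ A) :=
      fun x y hxy hx hy => ⟨fun h => hcl x h y hy hxy, fun h => hcl y h x hx hxy.symm⟩
    have hn : ∀ x y, (adjGraph α).Adj x y → (x ∈ E → y ∈ E ∨ y ∈ S) ∧ (y ∈ E → x ∈ E ∨ x ∈ S) :=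
      fun x y hxy => ⟨fun h' => h.mem_or_mem x h' y hxy, fun h' => h.mem_or_mem y h' x hxy.symm⟩
    have hd : ∀ x, x ∈ E → x ∉ S := fun x hx hx' => hES hx' hx
    have hA' : ∀ x, x ∈ A → x ∈ S := fun x hx => hA hx
    unfold cutWeight
    apply zmod_two_ite_add
    cases α with
    | four =>
      have a1 := hcl' p q (adj_eight_of_adj hpq)
      have a2 := hcl' q r (adj_eight_of_adj hqr)
      have a3 := hcl' r s (adj_eight_of_adj hrs)
      have a4 := hcl' s p (adj_eight_of_adj hsp)
      have a5 := hcl' p r hpr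
      have a6 := hcl' q s hqs
      have b1 := hn p q hpq
      have b2 := hn q r hqr
      have b3 := hn r s hrs
      have b4 := hn s p hsp
      clear hn hcl' hcl
      grind
    | eight =>
      have a1 := hcl' p q hpq
      have a2 := hcl' q r hqr
      have a3 := hcl' r s hrs
      have a4 := hcl' s p hsp
      have b1 := hn p q (adj_eight_of_adj hpq)
      have b2 := hn q r (adj_eight_of_adj hqr)
      have b3 := hn r s (adj_eight_of_adj hrs)
      have b4 := hn s p (adj_eight_of_adj hsp)
      have b5 := hn p r hpr
      have b6 := hn q s hqs
      clear hn hcl' hcl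
      grind
  apply key <;> simp [adj_four_iff, adj_eight_iff] <;> omega

/-- The set `S` is connected: it has no proper nonempty part that is closed under adjacency. -/
theorem subset_of_closed (h : Separates α T E S) (hA : A ⊆ S) (hne : A.Nonempty)
    (hcl : ∀ x ∈ A, ∀ y ∈ S, (adjGraph α.dual).Adj x y → y ∈ A) : S ⊆ A := by
  classical
  obtain ⟨φ, hφ1, hφ2⟩ := exists_potential (fun x y => cutWeight E A (x, y) (x + 1, y))
    (fun x y => cutWeight E A (x, y) (x, y + 1)) (h.cutWeight_square hA hcl)
  have hES := Set.disjoint_right.1 h.disjoint_right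
  have hTS := Set.disjoint_right.1 h.disjoint_left
  have hcomm : ∀ x y, cutWeight E A x y = cutWeight E A y x := fun x y => by
    simp only [cutWeight, or_comm]
  have hfour : ∀ x y, (adjGraph .four).Adj x y → φ y = φ x + cutWeight E A x y := by
    rintro ⟨x1, x2⟩ ⟨y1, y2⟩ hxy
    rw [adj_four_iff] at hxy
    dsimp only at hxy
    rcases hxy with ⟨rfl, rfl | rfl⟩ | ⟨rfl, rfl | rfl⟩
    · rw [hφ2, hcomm (_, _ + 1)]
      linear_combination -CharTwo.add_self_eq_zero (cutWeight E A (x1, y2) (x1, y2 + 1))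
    · rw [hφ2]
    · rw [hφ1, hcomm (_ + 1, _)]
      linear_combination -CharTwo.add_self_eq_zero (cutWeight E A (y1, x2) (y1 + 1, x2))
    · rw [hφ1]
  -- A diagonal edge is replaced by two `4`-edges through a corner `r`. If `x ∈ E`, then `r` and `y`
  -- lie in `E ∪ S` and the weights add up; if `x ∈ T`, none of the three points is in `E`.
  have hadj : ∀ x y, (adjGraph α).Adj x y → x ∈ E ∨ (x ∈ T ∧ (y ∈ T ∨ y ∈ S)) →
      φ y = φ x + cutWeight E A x y := by
    intro x y hxy hx
    cases α with
    | four => exact hfour x y hxy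
    | eight =>
      by_cases h4 : (adjGraph .four).Adj x y
      · exact hfour x y h4
      obtain ⟨r, hxr, hry⟩ : ∃ r, (adjGraph .four).Adj x r ∧ (adjGraph .four).Adj r y := by
        refine ⟨(x.1, y.2), ?_⟩
        rw [adj_four_iff] at *
        rw [adj_four_iff]
        rw [adj_eight_iff, ne_eq, Prod.ext_iff] at hxy
        dsimp only
        omega
      rw [hfour r y hry, hfour x r hxr, add_assoc]
      congr 1
      rcases hx with hx | ⟨hx, hy⟩
      · have hr := h.mem_or_mem x hx r (adj_eight_of_adj hxr)
        have hy := h.mem_or_mem x hx y hxy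
        have hxS : x ∉ S := fun h' => hES h' hx
        have hyA : y ∈ S → r ∈ S → (r ∈ A ↔ y ∈ A) := fun hy hr =>
          ⟨fun h' => hcl r h' y hy hry, fun h' => hcl y h' r hr hry.symm⟩
        have hrE : r ∈ E → r ∉ S := fun h' h'' => hES h'' h'
        have hyE : y ∈ E → y ∉ S := fun h' h'' => hES h'' h'
        have hAx := @hA x
        have hAr := @hA r
        have hAy := @hA y
        simp only [cutWeight]
        clear hcl
        rcases hr with hr | hr <;> rcases hy with hy | hy <;> by_cases r ∈ A <;>
          by_cases y ∈ A <;> grind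
      · have hxE : x ∉ E := fun h' => h.not_eq hx h' rfl
        have hrE : r ∉ E := fun h' => h.not_adj x hx r h' (adj_eight_of_adj hxr)
        have hyE : y ∉ E := fun h' => h.not_adj x hx y h' hxy
        simp [cutWeight, hxE, hrE, hyE]
  have hwalk : ∀ {B : Set Pixel}, (∀ x ∈ B, x ∈ E ∨ x ∈ T) → (∀ x ∈ B, x ∉ S) →
      ∀ x y, (within α B).Reachable x y → φ x = φ y := by
    intro B hB hBS x y hxy
    obtain ⟨w⟩ := hxy
    induction w with
    | nil => rfl
    | @cons x z y hxz _ ih =>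
      rw [← ih, hadj x z hxz.1]
      · have hx : x ∉ A := fun h' => hBS x hxz.2.1 (hA h')
        have hz : z ∉ A := fun h' => hBS z hxz.2.2 (hA h')
        simp [cutWeight, hx, hz]
      · rcases hB x hxz.2.1 with h1 | h1
        · exact Or.inl h1
        · refine Or.inr ⟨h1, Or.inl ?_⟩
          exact (hB z hxz.2.2).resolve_left fun h' => h.not_adj x h1 z h' hxz.1
  have hTconst := hwalk (B := T) (fun x hx => Or.inr hx) (fun x hx h' => hTS h' hx)
  have hEconst := hwalk (B := E) (fun x hx => Or.inl hx) (fun x hx h' => hES h' hx)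
  obtain ⟨a, ha⟩ := hne
  intro b hb
  by_contra hbA
  obtain ⟨ta, hta, hata⟩ := h.exists_left a (hA ha)
  obtain ⟨tb, htb, hbtb⟩ := h.exists_left b hb
  obtain ⟨ea, hea, haea⟩ := h.exists_right a (hA ha)
  obtain ⟨eb, heb, hbeb⟩ := h.exists_right b hb
  have h1 := hTconst _ _ (h.connected_left ta hta tb htb)
  have h2 := hEconst _ _ (h.connected_right ea hea eb heb)
  have h3 := hadj ta a hata.symm (Or.inr ⟨hta, Or.inr (hA ha)⟩)
  have h4 := hadj tb b hbtb.symm (Or.inr ⟨htb, Or.inr hb⟩)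
  have h5 := hadj ea a haea.symm (Or.inl hea)
  have h6 := hadj eb b hbeb.symm (Or.inl heb)
  have e1 : cutWeight E A ta a = 0 := by
    simp [cutWeight, hES (hA ha), Set.disjoint_left.1 h.disjoint hta]
  have e2 : cutWeight E A tb b = 0 := by
    simp [cutWeight, hES hb, Set.disjoint_left.1 h.disjoint htb]
  have e3 : cutWeight E A ea a = 1 := by simp [cutWeight, ha, hea]
  have e4 : cutWeight E A eb b = 0 := by simp [cutWeight, hbA, hES hb]
  -- Compare the passages from `T` to `E` through `a` and through `b`: only the first one meets an
  -- edge of weight one.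
  have : (1 : ZMod 2) = 0 := by
    linear_combination -e3 + e4 + e1 - e2 + h3 - h4 - h5 + h6 + h1 - h2
  exact one_ne_zero this

theorem connected (h : Separates α T E S) (hne : S.Nonempty) :
    ((adjGraph α.dual).induce S).Connected := by
  have := hne.to_subtype
  refine ⟨fun a b => ?_⟩
  have hsub := h.subset_of_closed
    (A := {x | ∃ hx : x ∈ S, ((adjGraph α.dual).induce S).Reachable a ⟨x, hx⟩})
    (fun x hx => hx.1) ⟨a, a.2, .refl _⟩ (fun x ⟨hx, hr⟩ y hy hxy =>
      ⟨hy, hr.trans (SimpleGraph.Adj.reachable hxy)⟩)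
  exact (hsub b.2).2

end Separates

/-! ### The site perimeter and the infinite component -/

theorem adj_of_adj_four (α : Conn) {x y : Pixel} (h : (adjGraph .four).Adj x y) :
    (adjGraph α).Adj x y := by
  cases α with
  | four => exact h
  | eight => exact adj_eight_of_adj h

theorem SimpleGraph.Reachable.within {α : Conn} {H : SimpleGraph Pixel} {A : Set Pixel}
    (hA : ∀ x ∈ A, ∀ y, H.Adj x y → (adjGraph α).Adj x y ∧ y ∈ A) {x y : Pixel} (hx : x ∈ A)
    (h : H.Reachable x y) : y ∈ A ∧ (within α A).Reachable x y := by
  obtain ⟨w⟩ := h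
  induction w with
  | nil => exact ⟨hx, .refl _⟩
  | @cons x z y hxz _ ih =>
    obtain ⟨h1, h2⟩ := hA x hx z hxz
    obtain ⟨h3, h4⟩ := ih h2
    exact ⟨h3, .trans (SimpleGraph.Adj.reachable ⟨h1, hx, h2⟩) h4⟩

theorem SimpleGraph.reachable_of_adj_int {V : Type*} {H : SimpleGraph V} {r : ℤ → V}
    (h : ∀ n, H.Adj (r n) (r (n + 1))) (m n : ℤ) : H.Reachable (r m) (r n) := by
  have h0 : ∀ n, H.Reachable (r 0) (r n) := fun n => by
    induction n using Int.induction_on with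
    | zero => exact .refl _
    | succ n ih => exact ih.trans (h n).reachable
    | pred n ih =>
      have := h (-n - 1)
      rw [sub_add_cancel] at this
      exact ih.trans this.symm.reachable
  exact (h0 m).symm.trans (h0 n)

section Perimeter

variable {α : Conn} {T : Set Pixel}

theorem IsConnComponent.nonempty {I : BinaryImage} (hT : IsConnComponent α I T) :
    T.Nonempty := by
  obtain ⟨x, -, rfl⟩ := hT
  exact ⟨x, .refl _⟩

theorem IsConnComponent.reachable {I : BinaryImage} (hT : IsConnComponent α I T) :
    ∀ t ∈ T, ∀ t' ∈ T, (within α T).Reachable t t' := by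
  obtain ⟨x, -, rfl⟩ := hT
  intro t ht t' ht'
  refine (SimpleGraph.Reachable.within (H := monochromaticGraph α I) ?_ ht
    (SimpleGraph.Reachable.trans ht.symm ht')).2
  exact fun y hy z hyz => ⟨hyz.1, SimpleGraph.Reachable.trans hy hyz.reachable⟩

theorem charGraph_adj {x y : Pixel} : (charGraph α T).Adj x y ↔
    (x ∉ sitePerimeter α T ∧ y ∉ sitePerimeter α T ∧ (adjGraph α).Adj x y) ∨
    (x ∈ sitePerimeter α T ∧ y ∈ sitePerimeter α T ∧ (adjGraph α.dual).Adj x y) := by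
  classical
  simp only [charGraph, imageGraph, perimeterImage]
  split_ifs <;> simp_all

theorem mem_exteriorRegion {z : Pixel} : z ∈ exteriorRegion α T ↔
    z ∉ sitePerimeter α T ∧ ((charGraph α T).connectedComponentMk z).supp.Infinite := by
  classical
  simp only [exteriorRegion, perimeterImage, Set.mem_ofPred_eq]
  split_ifs <;> simp_all

theorem Set.Finite.sitePerimeter (hT : T.Finite) : (sitePerimeter α T).Finite := by
  refine ((hT.prod (Set.finite_univ (α := Fin 8))).image (fun p => p.1 + ring p.2)).subset ?_
  rintro z ⟨-, t, ht, hzt⟩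
  obtain ⟨i, hi⟩ := exists_ring (adj_eight_of_adj hzt.symm)
  exact ⟨(t, i), ⟨ht, trivial⟩, hi.symm⟩

theorem charGraph_reachable_mem {x y : Pixel} (h : (charGraph α T).Reachable x y) :
    x ∈ sitePerimeter α T ↔ y ∈ sitePerimeter α T := by
  obtain ⟨w⟩ := h
  induction w with
  | nil => rfl
  | cons hxz _ ih =>
    rw [charGraph_adj] at hxz
    tauto

/-- Rows and columns that miss a box around the perimeter are white, and they join all points
outside the box to one another. An infinite component must leave the box. -/
theorem exists_unique_infinite (hT : T.Finite) :
    ∃ C : (charGraph α T).ConnectedComponent, C.supp = exteriorRegion α T ∧ C.supp.Infinite ∧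
      ∀ C' : (charGraph α T).ConnectedComponent, C'.supp.Infinite → C' = C := by
  obtain ⟨M, hM⟩ := ((hT.sitePerimeter (α := α)).image (fun z => max |z.1| |z.2|)).bddAbove
  have hP : ∀ z, M < |z.1| ∨ M < |z.2| → z ∉ sitePerimeter α T := by
    intro z hz hzP
    have := hM ⟨z, hzP, rfl⟩
    rw [max_le_iff] at this
    omega
  have hvert : ∀ x, M < |x| → ∀ y y', (charGraph α T).Reachable (x, y) (x, y') :=
    fun x hx => SimpleGraph.reachable_of_adj_int (r := fun y => (x, y)) fun y =>
      charGraph_adj.2 (Or.inl ⟨hP _ (Or.inl hx), hP _ (Or.inl hx),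
        adj_of_adj_four α (by simp [adj_four_iff])⟩)
  have hhor : ∀ y, M < |y| → ∀ x x', (charGraph α T).Reachable (x, y) (x', y) :=
    fun y hy => SimpleGraph.reachable_of_adj_int (r := fun x => (x, y)) fun x =>
      charGraph_adj.2 (Or.inl ⟨hP _ (Or.inr hy), hP _ (Or.inr hy),
        adj_of_adj_four α (by simp [adj_four_iff])⟩)
  -- The sign of `M` is unknown, as the perimeter may be empty here.
  have hM1 : M < |M + 1| := lt_of_lt_of_le (by omega) (le_abs_self _)
  have hout : ∀ z : Pixel, M < |z.1| ∨ M < |z.2| →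
      (charGraph α T).Reachable z (M + 1, M + 1) := by
    rintro ⟨x, y⟩ (hz | hz)
    · exact (hvert x hz y (M + 1)).trans (hhor _ hM1 _ _)
    · exact (hhor y hz x (M + 1)).trans (hvert _ hM1 _ _)
  have huniq : ∀ C' : (charGraph α T).ConnectedComponent, C'.supp.Infinite →
      C' = (charGraph α T).connectedComponentMk (M + 1, M + 1) := by
    intro C' hC'
    obtain ⟨z, hz, hzout⟩ : ∃ z ∈ C'.supp, M < |z.1| ∨ M < |z.2| := by
      by_contra! hcon
      refine hC' ((Set.finite_Icc ((-M, -M) : Pixel) (M, M)).subset fun z hz => ?_)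
      have := hcon z hz
      rw [abs_le, abs_le] at this
      exact ⟨⟨this.1.1, this.2.1⟩, ⟨this.1.2, this.2.2⟩⟩
    rw [← SimpleGraph.ConnectedComponent.mem_supp_iff _ _ |>.1 hz]
    exact SimpleGraph.ConnectedComponent.sound (hout z hzout)
  have hinf : ((charGraph α T).connectedComponentMk (M + 1, M + 1)).supp.Infinite := by
    refine Set.infinite_of_injective_forall_mem (f := fun x : ℤ => ((x, M + 1) : Pixel))
      (fun x y hxy => congrArg Prod.fst hxy) fun x => ?_
    exact SimpleGraph.ConnectedComponent.sound (hhor _ hM1 _ _)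
  refine ⟨_, ?_, hinf, huniq⟩
  ext z
  rw [mem_exteriorRegion]
  refine ⟨fun hz => ⟨?_, ?_⟩, fun hz => huniq _ hz.2⟩
  · rw [charGraph_reachable_mem (SimpleGraph.ConnectedComponent.exact hz)]
    exact hP _ (Or.inl hM1)
  · rwa [SimpleGraph.ConnectedComponent.mem_supp_iff _ _ |>.1 hz]

theorem mem_of_adj_of_notMem_sitePerimeter {t z : Pixel} (ht : t ∈ T)
    (htz : (adjGraph α).Adj t z) (hz : z ∉ sitePerimeter α T) : z ∈ T := by
  by_contra hzT
  exact hz ⟨hzT, t, ht, htz.symm⟩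

/-- An `α`-step out of `T` lands in the perimeter, so the component in `charGraph α T` of a point of
`T` stays in the finite set `T`. -/
theorem exteriorRegion_disjoint (hT : T.Finite) : Disjoint T (exteriorRegion α T) := by
  rw [Set.disjoint_left]
  intro t ht hte
  refine (mem_exteriorRegion.1 hte).2 (hT.subset fun z hz => ?_)
  refine (SimpleGraph.Reachable.within (α := α) (H := charGraph α T) ?_ ht
    (SimpleGraph.ConnectedComponent.exact hz).symm).1
  intro x hx y hxy
  rcases charGraph_adj.1 hxy with h | h
  · exact ⟨h.2.2, mem_of_adj_of_notMem_sitePerimeter hx h.2.2 h.2.1⟩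
  · exact (h.1.1 hx).elim

theorem mem_exteriorRegion_of_adj {e z : Pixel} (he : e ∈ exteriorRegion α T)
    (hez : (charGraph α T).Adj e z) : z ∈ exteriorRegion α T := by
  rw [mem_exteriorRegion] at *
  rwa [← charGraph_reachable_mem hez.reachable,
    ← SimpleGraph.ConnectedComponent.sound hez.reachable]

theorem IsConnComponent.separates {I : BinaryImage} (hT : IsConnComponent α I T)
    (hfin : T.Finite) : Separates α T (exteriorRegion α T) (extSitePerimeter α T) where
  disjoint := exteriorRegion_disjoint hfin
  not_adj t ht e he hte := Set.disjoint_left.1 (exteriorRegion_disjoint hfin)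
    (mem_of_adj_of_notMem_sitePerimeter ht hte (mem_exteriorRegion.1 he).1) he
  connected_left := hT.reachable
  connected_right e he e' he' := by
    obtain ⟨C, hC, -, -⟩ := exists_unique_infinite (α := α) hfin
    have hr : (charGraph α T).Reachable e e' := by
      rw [← hC] at he he'
      exact SimpleGraph.ConnectedComponent.exact (Eq.trans he (Eq.symm he'))
    refine (SimpleGraph.Reachable.within ?_ he hr).2
    intro x hx y hxy
    refine ⟨?_, mem_exteriorRegion_of_adj hx hxy⟩
    rcases charGraph_adj.1 hxy with h | h
    · exact h.2.2
    · exact ((mem_exteriorRegion.1 hx).1 h.1).elim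
  disjoint_left := Set.disjoint_right.2 fun _ hz => hz.1.1
  disjoint_right := Set.disjoint_left.2 fun _ he hz => (mem_exteriorRegion.1 he).1 hz.1
  exists_left _ hs := hs.1.2
  exists_right _ hs := hs.2
  mem_or_mem e he z hez := by
    by_cases hz : z ∈ sitePerimeter α T
    · exact Or.inr ⟨hz, e, he, hez.symm⟩
    · exact Or.inl (mem_exteriorRegion_of_adj he
        (charGraph_adj.2 (Or.inl ⟨(mem_exteriorRegion.1 he).1, hz, hez⟩)))

/-! ### Extreme points and the length bound -/

/-- A perimeter point just beyond an extreme point of `T` in a coordinate direction `d` lies on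
the exterior site perimeter. -/
theorem mem_extSitePerimeter_of_extreme {d : Pixel}
    (hd : d = (1, 0) ∨ d = (-1, 0) ∨ d = (0, 1) ∨ d = (0, -1)) {t z : Pixel} (ht : t ∈ T)
    (hmax : ∀ t' ∈ T, d.1 * t'.1 + d.2 * t'.2 ≤ d.1 * t.1 + d.2 * t.2)
    (hzt : (adjGraph α).Adj z t) (hz : d.1 * z.1 + d.2 * z.2 = d.1 * t.1 + d.2 * t.2 + 1) :
    z ∈ extSitePerimeter α T := by
  have hP : ∀ p ∈ sitePerimeter α T, d.1 * p.1 + d.2 * p.2 ≤ d.1 * t.1 + d.2 * t.2 + 1 := by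
    rintro p ⟨-, t', ht', hpt⟩
    have h1 := hmax t' ht'
    have h2 := adj_eight_iff.1 (adj_eight_of_adj hpt)
    rcases hd with rfl | rfl | rfl | rfl <;> dsimp only at * <;> omega
  have hdd : d.1 * d.1 + d.2 * d.2 = 1 := by
    rcases hd with rfl | rfl | rfl | rfl <;> rfl
  -- The perimeter reaches at most one level beyond `T` in direction `d`, and `z` is at that level.
  -- The ray that starts at `z + d` is therefore white and infinite.
  let r : ℕ → Pixel := fun k => (z.1 + (k + 1) * d.1, z.2 + (k + 1) * d.2)
  have hrP : ∀ k, r k ∉ sitePerimeter α T := by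
    intro k hk
    have := hP _ hk
    simp only [r] at this
    have h3 : d.1 * (z.1 + (k + 1) * d.1) + d.2 * (z.2 + (k + 1) * d.2) =
      d.1 * z.1 + d.2 * z.2 + (k + 1) * (d.1 * d.1 + d.2 * d.2) := by ring
    rw [h3, hdd] at this
    omega
  have hstep : ∀ x : Pixel, (adjGraph .four).Adj x (x.1 + d.1, x.2 + d.2) := by
    intro x
    rw [adj_four_iff]
    rcases hd with rfl | rfl | rfl | rfl <;> dsimp only <;> omega
  have hreach : ∀ k, (charGraph α T).Reachable (r k) (r 0) := by
    intro k
    induction k with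
    | zero => exact .refl _
    | succ k ih =>
      refine (SimpleGraph.Adj.reachable ?_).symm.trans ih
      refine charGraph_adj.2 (Or.inl ⟨hrP _, hrP _, adj_of_adj_four α ?_⟩)
      convert hstep (r k) using 1
      simp only [r, Prod.mk.injEq]
      push_cast
      constructor <;> ring
  refine ⟨⟨fun hzT => ?_, t, ht, hzt⟩, r 0, mem_exteriorRegion.2 ⟨hrP 0, ?_⟩, ?_⟩
  · have := hmax z hzT
    omega
  · refine Set.infinite_of_injective_forall_mem (f := r) (fun k l hkl => ?_)
      fun k => SimpleGraph.ConnectedComponent.sound (hreach k)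
    simp only [r, Prod.mk.injEq] at hkl
    rcases hd with rfl | rfl | rfl | rfl <;> dsimp only at hkl <;> omega
  · convert adj_of_adj_four α (hstep z) using 1
    simp [r]

theorem Set.Finite.extSitePerimeter (hT : T.Finite) : (extSitePerimeter α T).Finite :=
  hT.sitePerimeter.subset fun _ hz => hz.1

theorem List.Nodup.length_le_ncard {V : Type*} {l : List V} (hl : l.Nodup) {S : Set V}
    (hS : S.Finite) (h : ∀ x ∈ l, x ∈ S) : l.length ≤ S.ncard := by
  classical
  rw [← List.toFinset_card_of_nodup hl, ← Set.ncard_coe_finset]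
  exact Set.ncard_le_ncard (fun x hx => h x (by simpa using hx)) hS

theorem minCycleLength_le_ncard (hne : T.Nonempty) (hT : T.Finite) :
    α.dual.minCycleLength ≤ (extSitePerimeter α T).ncard := by
  have hex : ∀ d : Pixel, ∃ t ∈ T, ∀ t' ∈ T, d.1 * t'.1 + d.2 * t'.2 ≤ d.1 * t.1 + d.2 * t.2 :=
    fun d => Set.exists_max_image T _ hT hne
  obtain ⟨⟨a1, a2⟩, ha, hamax⟩ := hex (1, 0)
  obtain ⟨⟨b1, b2⟩, hb, hbmax⟩ := hex (-1, 0)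
  obtain ⟨⟨c1, c2⟩, hc, hcmax⟩ := hex (0, 1)
  obtain ⟨⟨d1, d2⟩, hd, hdmax⟩ := hex (0, -1)
  have ha' := fun z => mem_extSitePerimeter_of_extreme (α := α) (z := z) (by simp) ha hamax
  have hb' := fun z => mem_extSitePerimeter_of_extreme (α := α) (z := z) (by simp) hb hbmax
  have hc' := fun z => mem_extSitePerimeter_of_extreme (α := α) (z := z) (by simp) hc hcmax
  have hd' := fun z => mem_extSitePerimeter_of_extreme (α := α) (z := z) (by simp) hd hdmax
  have hab := hamax _ hb
  have hac := hamax _ hc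
  have had := hamax _ hd
  have hbc := hbmax _ hc
  have hbd := hbmax _ hd
  have hca := hcmax _ ha
  have hcb := hcmax _ hb
  have hcd := hcmax _ hd
  have hda := hdmax _ ha
  have hdb := hdmax _ hb
  dsimp only at *
  cases α with
  | four =>
    refine List.Nodup.length_le_ncard (V := Pixel)
      (l := [(a1 + 1, a2), (b1 - 1, b2), (c1, c2 + 1), (d1, d2 - 1)]) ?_ hT.extSitePerimeter ?_
    · simp only [List.nodup_cons, List.mem_cons, Prod.mk.injEq, List.not_mem_nil, List.nodup_nil,
        or_false, not_false_eq_true, and_true]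
      omega
    · simp only [List.forall_mem_cons, List.not_mem_nil, false_imp_iff, implies_true, and_true]
      refine ⟨ha' _ ?_ ?_, hb' _ ?_ ?_, hc' _ ?_ ?_, hd' _ ?_ ?_⟩ <;>
        (try rw [adj_four_iff]) <;> dsimp only <;> omega
  | eight =>
    -- Three points above, three below and one on each side. The diagonal neighbors beside the left
    -- and right extremes are left out, since they may coincide with those above and below.
    refine List.Nodup.length_le_ncard (V := Pixel)
      (l := [(a1 + 1, a2), (b1 - 1, b2), (c1, c2 + 1), (c1 - 1, c2 + 1), (c1 + 1, c2 + 1),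
        (d1, d2 - 1), (d1 - 1, d2 - 1), (d1 + 1, d2 - 1)]) ?_ hT.extSitePerimeter ?_
    · simp only [List.nodup_cons, List.mem_cons, Prod.mk.injEq, List.not_mem_nil, List.nodup_nil,
        or_false, not_false_eq_true, and_true]
      omega
    · simp only [List.forall_mem_cons, List.not_mem_nil, false_imp_iff, implies_true, and_true]
      refine ⟨ha' _ ?_ ?_, hb' _ ?_ ?_, hc' _ ?_ ?_, hc' _ ?_ ?_, hc' _ ?_ ?_, hd' _ ?_ ?_,
        hd' _ ?_ ?_, hd' _ ?_ ?_⟩ <;>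
        (try rw [adj_eight_iff, ne_eq, Prod.mk.injEq]) <;> dsimp only <;> omega

end Perimeter

theorem lemma5p1 (α : Conn) (I : BinaryImage) (T : Set Pixel)
    (hT : IsConnComponent α I T) (hfin : T.Finite) :
    (∃ C : (charGraph α T).ConnectedComponent,
      C.supp = exteriorRegion α T ∧ C.supp.Infinite ∧
        ∀ C' : (charGraph α T).ConnectedComponent, C'.supp.Infinite → C' = C) ∧
    IsSimpleCycle α.dual (extSitePerimeter α T) := by
  have hsep := hT.separates hfin
  have hmin := minCycleLength_le_ncard (α := α) hT.nonempty hfin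
  have hfinS := hfin.extSitePerimeter (α := α)
  have hne : (extSitePerimeter α T).Nonempty := by
    refine Set.nonempty_of_ncard_ne_zero (ne_of_gt (lt_of_lt_of_le ?_ hmin))
    cases α <;> simp [Conn.dual, Conn.minCycleLength]
  have := hfinS.to_subtype
  exact ⟨exists_unique_infinite hfin, _, hmin,
    (hsep.connected hne).nonempty_iso_cycleGraph hsep.ncard_neighborSet⟩
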